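/- **Setting.** Let $d\in\mathbb N$, let $E$ be a finite set and $\Omega=E^{\mathbb Z^{d}\times\mathbb Z}$ with the product topology and product $\sigma$-algebra $\mathcal F$; for $\eta\in\Omega$ write $\eta_t(x)$ for its value at $(x,t)$. For $\Delta\subset\mathbb Z^{d}\times\mathbb Z$ let $\mathcal F_\Delta$ be the $\sigma$-algebra generated by the coordinates in $\Delta$. Put $(\theta_{x,t}\eta)_s(y)=\eta_{s+t}(y+x)$. Let $\mathbb P$ be a probability measure on $\Omega$ invariant under all shifts $\theta_{x,t}$, $(x,t)\in\mathbb Z^d\times\mathbb Z$. For each $\eta\in\Omega$ let $\alpha(\eta,\cdot)$ be a probability vector on $\mathbb Z^d$. Let $\mathcal R=\{y:\sup_\eta\alpha(\eta,y)>0\}$ and assume that $o\in\mathcal R$ and that there is a fixed $R\in\mathbb N$ such that $\|y\|_1\le R$ for all $y\in\mathcal R$ and $\alpha(\eta,\cdot)$ depends on $\eta$ only through its restriction to $[-R,R]^d\times\{0\}$. Under the quenched law $P_\eta$, the walk $(X_t)_{t\ge 0}$ starts at $X_0=o$ and jumps at time $t$ from $y$ to $y+z$ with probability $\alpha(\theta_{y,t}\eta,z)$.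 For a probability measure $Q$ on $\Omega$ let $P_{Q}$ be the joint law of $(\eta,X)$, with $\eta\sim Q$ and $X\sim P_\eta$ given $\eta$. The environment process is $\eta^{EP}_t=\theta_{X_t,t}\eta$, and $Q$ is called invariant under it if $P_Q(\eta^{EP}_t\in\cdot)=Q$ for all $t\ge 0$. The walk is elliptic if $\alpha(\eta,y)>0$ for all $\eta\in\Omega$ and $y\in\mathcal R$. Let $\mathcal A_{-\infty}$ be the set of all events of positive $\mathbb P$-probability of the form $$\bigcap_{i=-k}^{-1}\big\{\eta:(\theta_{\gamma_i,i}\eta)_0(y)=\sigma_i(y)\ \text{ for all } y\in[-R,R]^d\big\},$$ where $k\ge 1$, $\sigma\in\Omega$, $\gamma_{-k},\dots,\gamma_0\in\mathbb Z^d$, $\gamma_0=o$, and $\gamma_i-\gamma_{i-1}\in\mathcal R$ for $-k<i\le 0$. Let $\mathbb H=\mathbb Z^d\times\mathbb Z_{\ge 0}$, $\mathcal F_{\ge 0}=\mathcal F_{\mathbb H}$, $\Lambda(l)=\{(x,t)\in\mathbb H:\|x\|_1+|t|\ge l\}$, $\mathcal F^\infty_{\ge 0}=\bigcap_{l}\mathcal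 F_{\Lambda(l)}$, $\mathcal C(j)=\{(x,t)\in\mathbb H:\|x\|_1\le(R+1)t,\ t\ge j\}$ and $\mathcal F^\infty_\infty=\bigcap_j\mathcal F_{\mathcal C(j)}$. **Theorem 1.4 (Absolute continuity).** Let $\phi:\mathbb N\to[0,1]$ satisfy $\lim_{l\to\infty}\phi(l)=0$ and $$\sup_{B\in\mathcal F_{\Lambda(l)}}\ \sup_{A\in\mathcal A_{-\infty}}\big|\mathbb P(B\mid A)-\mathbb P(B)\big|\le\phi(l)\qquad\text{for all } l .$$ Then the sequence of Cesàro averages $\frac1n\sum_{t=0}^{n-1}P_{\mathbb P}(\eta^{EP}_t\in\cdot)$ has at least one weak subsequential limit, and every such limit $\mathbb P^{EP}$ is a probability measure on $\Omega$, invariant under the environment process, with $\mathbb P^{EP}=\mathbb P$ on $\mathcal F^\infty_\infty$, for which 1. $\mathbb P^{EP}=\mathbb P$ on $\mathcal F^\infty_{\ge 0}$; 2. $\displaystyle\sup_{B\in\mathcal F_{\Lambda(l)}}|\mathbb P(B)-\mathbb P^{EP}(B)|\le\phi(l)$ for all $l$; 3. if in addition the walk is elliptic, then $\mathbb P$ and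 $\mathbb P^{EP}$ are mutually absolutely continuous on $(\Omega,\mathcal F_{\ge 0})$. -/

import Mathlib

open MeasureTheory ProbabilityTheory Filter Topology

namespace RWDRE

/-- Space-time `ℤ^{d+1} = ℤ^d × ℤ`; a point is `(x, t)` with `x` in space and `t` in time. -/
abbrev Site (d : ℕ) : Type := (Fin d → ℤ) × ℤ

/-- The space `Ω = E^{ℤ^{d+1}}` of environments, with the product `σ`-algebra and topology. -/
abbrev Env (d : ℕ) (E : Type*) : Type _ := Site d → E

/-- The shift `θ_{x,t}`, given by `(θ_{x,t} η)_s(y) = η_{s+t}(y+x)`. -/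
def shift {d : ℕ} {E : Type*} (x : Fin d → ℤ) (t : ℤ) (η : Env d E) : Env d E :=
  fun p => η (p.1 + x, p.2 + t)

/-- The `ℓ¹`-norm on `ℤ^d`. -/
def norm1 {d : ℕ} (x : Fin d → ℤ) : ℕ := ∑ i, (x i).natAbs

/-- `Λ(l)`: the points of the forward half-space `t ≥ 0` at `ℓ¹`-distance at least `l` from the
space-time origin. -/
def farHalfSpace (d l : ℕ) : Set (Site d) :=
  {p | 0 ≤ p.2 ∧ l ≤ norm1 p.1 + p.2.natAbs}

/-- `𝓗 = ℤ^d × ℤ_{≥ 0}`, the forward half-space. -/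
def halfSpace (d : ℕ) : Set (Site d) := {p | 0 ≤ p.2}

/-- `𝓒(j)`: the points at time at least `j` of the forward cone `‖x‖₁ ≤ (R + 1) t`, `t ≥ 0`. -/
def forwardCone (d R j : ℕ) : Set (Site d) :=
  {p | 0 ≤ p.2 ∧ (norm1 p.1 : ℤ) ≤ (R + 1) * p.2 ∧ (j : ℤ) ≤ p.2}

section

variable {d : ℕ} {E : Type*}

/-- `𝓕_{≥ 0}^∞ = ⋂_l 𝓕_{Λ(l)}`, where `𝓕_Λ` (`cylinderEvents Λ`) is generated by the coordinates
in `Λ`. -/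
abbrev halfSpaceTail (d : ℕ) (E : Type*) [MeasurableSpace E] : MeasurableSpace (Env d E) :=
  ⨅ l : ℕ, cylinderEvents (farHalfSpace d l)

/-- `𝓕_∞^∞ = ⋂_j 𝓕_{𝓒(j)}`. -/
abbrev coneTail (d : ℕ) (E : Type*) [MeasurableSpace E] (R : ℕ) : MeasurableSpace (Env d E) :=
  ⨅ j : ℕ, cylinderEvents (forwardCone d R j)

/-- The jump rule of the random walk: `α η` is the probability vector `z ↦ α(η, z)` on `ℤ^d`. -/
structure Walk (d : ℕ) (E : Type*) where
  /-- the transition probabilities `α(η, ·)` -/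
  α : Env d E → PMF (Fin d → ℤ)
  /-- the range of the walk -/
  R : ℕ
  /-- `α(η, ·)` depends on `η` only through `[-R, R]^d × {0}` -/
  local_dep : ∀ η σ : Env d E,
    (∀ x : Fin d → ℤ, (∀ i, |x i| ≤ (R : ℤ)) → η (x, 0) = σ (x, 0)) → α η = α σ
  /-- possible jumps have `ℓ¹`-norm at most `R`; in particular there are finitely many of them -/
  range_bdd : ∀ (η : Env d E) (y : Fin d → ℤ), 0 < α η y → norm1 y ≤ R
  /-- the origin belongs to the jump range -/
  zero_mem : ∃ η : Env d E, 0 < α η 0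

namespace Walk

/-- The jump range `{y : sup_η α(η, y) > 0}`. -/
def jumpRange (W : Walk d E) : Set (Fin d → ℤ) := {y | ∃ η, 0 < W.α η y}

/-- The walk is elliptic: every jump in the jump range has positive probability in every
environment. -/
def IsElliptic (W : Walk d E) : Prop := ∀ y ∈ W.jumpRange, ∀ η, 0 < W.α η y

/-- The family `𝓐_{-∞}` of possible observations along backward paths ending at `(o, 0)`: for
`k ≥ 1`, a path `γ_{-k}, …, γ_0 = o` with increments in the jump range and `σ ∈ Ω`, the event that
the environment seen from `(γ_i, i)` equals `σ_i` on `[-R, R]^d` for `i = -k, …, -1`, provided that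
this event has positive probability. Only the values `γ_i`, `-k ≤ i ≤ 0`, matter. -/
def observations [MeasurableSpace E] (W : Walk d E) (P : Measure (Env d E)) :
    Set (Set (Env d E)) :=
  {A | ∃ (k : ℕ) (γ : ℤ → Fin d → ℤ) (σ : Env d E), 1 ≤ k ∧ γ 0 = 0 ∧
    (∀ i : ℤ, -k < i → i ≤ 0 → γ i - γ (i - 1) ∈ W.jumpRange) ∧
    A = {η | ∀ i : ℤ, -k ≤ i → i ≤ -1 → ∀ y : Fin d → ℤ, (∀ j, |y j| ≤ (W.R : ℤ)) →
      shift (γ i) i η (y, 0) = σ (y, i)} ∧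
    0 < P A}

/-- The transition kernel of the walk in the fixed environment `η` at time `n`: from a history
ending at `y`, jump to `y + z` with probability `α(θ_{y,n} η, z)`. -/
noncomputable def step (W : Walk d E) (η : Env d E) (n : ℕ) :
    Kernel ((i : Finset.Iic n) → Fin d → ℤ) (Fin d → ℤ) where
  toFun h :=
    ((W.α (shift (h ⟨n, Finset.mem_Iic.2 le_rfl⟩) n η)).map
      (fun z => h ⟨n, Finset.mem_Iic.2 le_rfl⟩ + z)).toMeasure
  measurable' := measurable_of_countable _

instance (W : Walk d E) (η : Env d E) (n : ℕ) : IsMarkovKernel (W.step η n) :=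
  ⟨fun h => by change IsProbabilityMeasure (PMF.toMeasure _); infer_instance⟩

/-- The quenched law `P_η` on trajectories `(X_t)_{t ≥ 0}`, started at `X_0 = o`. -/
noncomputable def quenchedLaw (W : Walk d E) (η : Env d E) : Measure (ℕ → Fin d → ℤ) :=
  Kernel.traj (X := fun _ => Fin d → ℤ) (W.step η) 0 (fun _ => 0)

instance (W : Walk d E) (η : Env d E) : IsProbabilityMeasure (W.quenchedLaw η) := by
  unfold quenchedLaw; infer_instance

theorem step_singleton (W : Walk d E) (η : Env d E) (n : ℕ) (p : ℕ → Fin d → ℤ) :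
    W.step η n (Preorder.frestrictLe n p) {p (n + 1)} =
      W.α (shift (p n) n η) (p (n + 1) - p n) := by
  change PMF.toMeasure (PMF.map (fun z => p n + z) (W.α (shift (p n) n η))) {p (n + 1)} = _
  rw [PMF.toMeasure_apply_singleton _ _ (measurableSet_singleton _), PMF.map_apply,
    tsum_eq_single (p (n + 1) - p n)]
  · simp
  · intro b hb
    rw [if_neg]
    rintro h
    exact hb (by rw [h]; abel)

/-- Path probabilities under the quenched law. -/
theorem quenchedLaw_path (W : Walk d E) (η : Env d E) (p : ℕ → Fin d → ℤ) (hp : p 0 = 0) (n : ℕ) :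
    W.quenchedLaw η {X | ∀ i ≤ n, X i = p i} =
      ∏ i ∈ Finset.range n, W.α (shift (p i) i η) (p (i + 1) - p i) := by
  have hset : ∀ m : ℕ, {X : ℕ → Fin d → ℤ | ∀ i ≤ m, X i = p i} =
      Preorder.frestrictLe (π := fun _ => Fin d → ℤ) m ⁻¹' {Preorder.frestrictLe m p} := by
    intro m
    ext X
    simp [funext_iff, Preorder.frestrictLe]
  have hpt : ∀ m : ℕ, W.quenchedLaw η {X | ∀ i ≤ m, X i = p i} =
      Kernel.partialTraj (X := fun _ => Fin d → ℤ) (W.step η) 0 m (fun _ => 0)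
        {Preorder.frestrictLe m p} := by
    intro m
    rw [hset, quenchedLaw, ← Kernel.traj_map_frestrictLe_apply,
      Measure.map_apply (Preorder.measurable_frestrictLe m) (measurableSet_singleton _)]
  induction n with
  | zero =>
    rw [hpt, Kernel.partialTraj_self, Kernel.id_apply]
    rw [Measure.dirac_apply' _ (measurableSet_singleton _)]
    have : (fun _ => 0 : (i : Finset.Iic 0) → Fin d → ℤ) = Preorder.frestrictLe 0 p := by
      funext i
      have hi : (i : ℕ) = 0 := Nat.le_zero.1 (Finset.mem_Iic.1 i.2)
      simp [Preorder.frestrictLe, hi, hp]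
    rw [this]; simp
  | succ n ih =>
    have h2 : {X : ℕ → Fin d → ℤ | ∀ i ≤ n + 1, X i = p i} =
        (fun X : ℕ → Fin d → ℤ =>
          (Preorder.frestrictLe (π := fun _ => Fin d → ℤ) n X, X (n + 1))) ⁻¹'
          ({Preorder.frestrictLe n p} ×ˢ {p (n + 1)}) := by
      rw [Set.mk_preimage_prod, ← hset]
      ext X
      constructor
      · intro h
        exact ⟨fun i hi => h i (by omega), h (n + 1) le_rfl⟩
      · rintro ⟨h, h'⟩ i hi
        rcases Nat.lt_or_ge n i with hlt | hle
        · have : i = n + 1 := by omega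
          subst this; exact h'
        · exact h i hle
    rw [h2, quenchedLaw, ← Measure.map_apply _ ((measurableSet_singleton _).prod
      (measurableSet_singleton _)), ← Kernel.partialTraj_compProd_eq_map_traj (Nat.zero_le n),
      Measure.compProd_apply_prod (measurableSet_singleton _) (measurableSet_singleton _),
      lintegral_singleton, step_singleton, ← hpt, ih, Finset.prod_range_succ, mul_comm]
    exact (Preorder.measurable_frestrictLe n).prodMk (measurable_pi_apply _)

theorem measurable_shift [MeasurableSpace E] (x : Fin d → ℤ) (t : ℤ) :
    Measurable (shift (E := E) x t) :=
  measurable_pi_lambda _ fun _ => measurable_pi_apply _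

theorem measurable_α [Finite E] [MeasurableSpace E] [DiscreteMeasurableSpace E] (W : Walk d E)
    (z : Fin d → ℤ) : Measurable fun η => W.α η z := by
  have hfin : Set.Finite {x : Fin d → ℤ | ∀ i, |x i| ≤ (W.R : ℤ)} := by
    refine (Set.finite_Icc (fun _ : Fin d => -(W.R : ℤ)) (fun _ => (W.R : ℤ))).subset ?_
    intro x hx
    exact ⟨fun i => (abs_le.1 (hx i)).1, fun i => (abs_le.1 (hx i)).2⟩
  have : Finite {x : Fin d → ℤ | ∀ i, |x i| ≤ (W.R : ℤ)} := hfin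
  let r : Env d E → ({x : Fin d → ℤ | ∀ i, |x i| ≤ (W.R : ℤ)} → E) := fun η x => η (x.1, 0)
  have hr : Measurable r := measurable_pi_lambda _ fun _ => measurable_pi_apply _
  have hfac : Function.FactorsThrough (fun η => W.α η z) r := by
    intro η σ h
    have : W.α η = W.α σ := W.local_dep η σ fun x hx => congrFun h ⟨x, hx⟩
    simp only [this]
  rw [← hfac.extend_comp (fun _ => 0)]
  exact (measurable_of_countable _).comp hr

theorem measurable_quenchedLaw [Finite E] [MeasurableSpace E] [DiscreteMeasurableSpace E]
    (W : Walk d E) : Measurable W.quenchedLaw := by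
  refine Measurable.measure_of_isPiSystem_of_isProbabilityMeasure
    (generateFrom_measurableCylinders (α := fun _ : ℕ => Fin d → ℤ)).symm
    isPiSystem_measurableCylinders ?_
  intro s hs
  obtain ⟨N, S, mS, rfl⟩ : ∃ N S, MeasurableSet S ∧
      s = cylinder (α := fun _ : ℕ => Fin d → ℤ) (Finset.Iic N) S := by
    simpa [measurableCylinders_nat] using hs
  have hS : cylinder (α := fun _ : ℕ => Fin d → ℤ) (Finset.Iic N) S =
      ⋃ q ∈ S, {X | ∀ i ≤ N, X i = if h : i ≤ N then q ⟨i, Finset.mem_Iic.2 h⟩ else 0} := by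
    ext X
    simp only [mem_cylinder, Set.mem_iUnion, Set.mem_ofPred_eq, exists_prop]
    constructor
    · intro h
      exact ⟨_, h, fun i hi => by simp [hi]⟩
    · rintro ⟨q, hq, h⟩
      convert hq using 1
      funext i
      have hi := Finset.mem_Iic.1 i.2
      simpa [hi] using h i hi
  have hmeas : ∀ p : ℕ → Fin d → ℤ,
      Measurable fun η => W.quenchedLaw η {X | ∀ i ≤ N, X i = p i} := by
    intro p
    by_cases hp : p 0 = 0
    · simp only [quenchedLaw_path W _ p hp]
      exact Finset.measurable_prod _ fun i _ => (W.measurable_α _).comp (measurable_shift _ _)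
    · have h0 : ∀ η, W.quenchedLaw η {X | ∀ i ≤ N, X i = p i} = 0 := by
        intro η
        have h1 := quenchedLaw_path W η (fun _ => 0) rfl 0
        simp only [Finset.range_zero, Finset.prod_empty] at h1
        refine measure_mono_null (t := {X | ∀ i ≤ 0, X i = 0}ᶜ) ?_ ?_
        · intro X hX hX'
          exact hp ((hX 0 (Nat.zero_le _)).symm.trans (hX' 0 le_rfl))
        · rw [prob_compl_eq_zero_iff]
          · exact h1
          · simp only [Nat.le_zero, forall_eq]
            exact measurable_pi_apply 0 (measurableSet_singleton _)
      simp only [h0, measurable_const]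
  have hms : ∀ p : ℕ → Fin d → ℤ,
      MeasurableSet {X : ℕ → Fin d → ℤ | ∀ i ≤ N, X i = p i} := by
    intro p
    have : {X : ℕ → Fin d → ℤ | ∀ i ≤ N, X i = p i} =
        ⋂ i ∈ Set.Iic N, (fun X => X i) ⁻¹' {p i} := by
      ext X; simp
    rw [this]
    exact MeasurableSet.biInter (Set.to_countable _) fun i _ =>
      measurable_pi_apply i (measurableSet_singleton _)
  have hsum : ∀ η, W.quenchedLaw η (cylinder (Finset.Iic N) S) = ∑' q : S, W.quenchedLaw η
      {X | ∀ i ≤ N, X i = if h : i ≤ N then q.1 ⟨i, Finset.mem_Iic.2 h⟩ else 0} := by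
    intro η
    rw [hS, measure_biUnion (Set.to_countable S)]
    · intro q _ q' _ hne
      refine Set.disjoint_left.2 fun X hX hX' => hne ?_
      funext i
      have hi := Finset.mem_Iic.1 i.2
      have e1 := hX i hi
      have e2 := hX' i hi
      simp only [hi, dif_pos] at e1 e2
      exact e1.symm.trans e2
    · exact fun q _ => hms _
  simp only [hsum]
  exact Measurable.tsum fun q => hmeas _

/-- The quenched law as a Markov kernel from environments to trajectories. -/
noncomputable def quenched [Finite E] [MeasurableSpace E] [DiscreteMeasurableSpace E]
    (W : Walk d E) : Kernel (Env d E) (ℕ → Fin d → ℤ) where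
  toFun := W.quenchedLaw
  measurable' := W.measurable_quenchedLaw

instance [Finite E] [MeasurableSpace E] [DiscreteMeasurableSpace E] (W : Walk d E) :
    IsMarkovKernel W.quenched :=
  ⟨fun η => inferInstanceAs (IsProbabilityMeasure (W.quenchedLaw η))⟩

/-- The joint law `P_P` of `(η, X)`: `P_P(B × A) = ∫_B P_η(A) dP(η)`. -/
noncomputable def jointLaw [Finite E] [MeasurableSpace E] [DiscreteMeasurableSpace E]
    (W : Walk d E) (P : Measure (Env d E)) : Measure (Env d E × (ℕ → Fin d → ℤ)) :=
  P ⊗ₘ W.quenched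

end Walk

/-- The environment process `η_t^{EP} = θ_{X_t, t} η`. -/
def envProcess (t : ℕ) (ω : Env d E × (ℕ → Fin d → ℤ)) : Env d E :=
  shift (ω.2 t) t ω.1

theorem measurable_envProcess [MeasurableSpace E] (t : ℕ) :
    Measurable (envProcess (d := d) (E := E) t) := by
  have h : Measurable fun q : Env d E × (Fin d → ℤ) => shift q.2 (t : ℤ) q.1 :=
    measurable_from_prod_countable_left fun y => Walk.measurable_shift y t
  exact h.comp (measurable_fst.prodMk ((measurable_pi_apply t).comp measurable_snd))

namespace Walk

variable [Finite E] [MeasurableSpace E] [DiscreteMeasurableSpace E]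

/-- The law `P_P(η_t^{EP} ∈ ·)`. -/
noncomputable def envLaw (W : Walk d E) (P : Measure (Env d E)) (t : ℕ) : Measure (Env d E) :=
  (W.jointLaw P).map (envProcess t)

instance (W : Walk d E) (P : Measure (Env d E)) [IsProbabilityMeasure P] (t : ℕ) :
    IsProbabilityMeasure (W.envLaw P t) := by
  unfold envLaw jointLaw
  exact Measure.isProbabilityMeasure_map (measurable_envProcess t).aemeasurable

/-- `Q` is invariant under the environment process: started from `Q`, the process has law `Q` at
all times. -/
def IsInvariant (W : Walk d E) (Q : Measure (Env d E)) : Prop := ∀ t : ℕ, W.envLaw Q t = Q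

/-- The Cesàro average `(n+1)⁻¹ ∑_{t=0}^{n} P_P(η_t^{EP} ∈ ·)`. -/
noncomputable def cesaro (W : Walk d E) (P : ProbabilityMeasure (Env d E)) (n : ℕ) :
    ProbabilityMeasure (Env d E) :=
  ⟨((n : ENNReal) + 1)⁻¹ • ∑ t ∈ Finset.range (n + 1), W.envLaw (P : Measure (Env d E)) t, ⟨by
    simp only [Measure.smul_apply, Measure.finsetSum_apply, measure_univ, Finset.sum_const,
      Finset.card_range, smul_eq_mul, nsmul_eq_mul, mul_one, Nat.cast_add, Nat.cast_one]
    exact ENNReal.inv_mul_cancel (by simp) (by finiteness)⟩⟩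

/-- `Q` is a law `P^{EP}` of the environment seen from the walker: a weak limit, along a
subsequence, of the Cesàro averages of the laws of the environment process started from `P`. -/
def IsEnvLimit [TopologicalSpace E] [DiscreteTopology E] (W : Walk d E)
    (P Q : ProbabilityMeasure (Env d E)) : Prop :=
  ∃ n : ℕ → ℕ, StrictMono n ∧ Tendsto (fun k => W.cesaro P (n k)) atTop (𝓝 Q)

end Walk

end

end RWDRE

/-! ### Shifts and finite local patterns -/

namespace RWDRE

variable {d : ℕ} {E : Type*}

/-! The law of the environment seen from the walker evolves linearly: `stepLaw` sends a measure ν to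
a finite sum, over local patterns τ and jumps z, of the probability of z given τ times the image
under θ_{z,1} of ν restricted to τ. Since P is shift invariant, applying this to P restricted to a
backward-path observation gives a nonnegative combination of restrictions of P to observations along
paths one step longer. Hence the law at time t is a mixture of conditional laws of P given
observations, and each of these is φ(l)-close to P on 𝓕_{Λ(l)} by the mixing hypothesis
(`massNear_stepLaw_pow_restrict_pathEvent`).

The bound survives Cesàro averages. It passes to weak limits on clopen events, whose boundary is
empty, and then to all of 𝓕_{Λ(l)} by approximation (`le_add_of_clopenEvents`). Letting l → ∞ gives
equality on the tails. Limits exist because Ω is compact, and they are fixed by `stepLaw` because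
the averages telescope and `stepLaw` acts continuously on clopen events.

For absolute continuity, let B be in 𝓕_{≥0}, so that its translates by (x,t) lie in 𝓕_{Λ(t)}. If P B
= 0, stationarity bounds Q B by the Q-mass of the union over x of these translates, which is P-null,
so Q B ≤ φ(t). If Q B = 0, ellipticity and the allowed jump o make the translates by (o,t) Q-null,
so P B ≤ φ(t). -/

theorem shift_shift (x y : Fin d → ℤ) (s t : ℤ) (η : Env d E) :
    shift x s (shift y t η) = shift (x + y) (s + t) η := by
  funext p
  simp [shift, add_assoc]

@[simp]
theorem shift_zero (η : Env d E) : shift 0 0 η = η := by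
  funext p
  simp [shift]

/-- The box `[-R, R]^d`. -/
abbrev Box (d R : ℕ) : Type := {x : Fin d → ℤ // ∀ i, |x i| ≤ (R : ℤ)}

instance (d R : ℕ) : Finite (Box d R) := by
  have h : {x : Fin d → ℤ | ∀ i, |x i| ≤ (R : ℤ)}.Finite := by
    refine (Set.finite_Icc (fun _ : Fin d => -(R : ℤ)) (fun _ => (R : ℤ))).subset ?_
    intro x hx
    exact ⟨fun i => (abs_le.1 (hx i)).1, fun i => (abs_le.1 (hx i)).2⟩
  exact h.to_subtype

/-- The `ℓ¹`-ball of radius `R`. -/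
abbrev Jump (d R : ℕ) : Type := {z : Fin d → ℤ // norm1 z ≤ R}

theorem abs_le_norm1 (z : Fin d → ℤ) (i : Fin d) : |z i| ≤ (norm1 z : ℤ) := by
  rw [Int.abs_eq_natAbs]
  exact_mod_cast Finset.single_le_sum (f := fun i => (z i).natAbs) (fun _ _ => Nat.zero_le _)
    (Finset.mem_univ i)

instance (d R : ℕ) : Finite (Jump d R) :=
  Finite.of_injective
    (fun z : Jump d R =>
      (⟨z.1, fun i => (abs_le_norm1 z.1 i).trans (by exact_mod_cast z.2)⟩ : Box d R))
    fun _ _ h => Subtype.ext (congrArg (fun x : Box d R => x.1) h)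

noncomputable instance (d R : ℕ) : Fintype (Jump d R) := Fintype.ofFinite _

noncomputable instance [Finite E] (d R : ℕ) : Fintype (Box d R → E) := Fintype.ofFinite _

/-- The pattern of `η` on `[-R, R]^d × {0}`. -/
def pattern (R : ℕ) (η : Env d E) : Box d R → E := fun x => η (x.1, 0)

/-- The event of seeing the pattern `τ` on `[-R, R]^d × {0}`. -/
def cell {R : ℕ} (τ : Box d R → E) : Set (Env d E) := {η | pattern R η = τ}

theorem measurableSet_cell [MeasurableSpace E] [DiscreteMeasurableSpace E] [Finite E]
    {R : ℕ} (τ : Box d R → E) : MeasurableSet (cell τ) := by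
  have h : Measurable (pattern (d := d) (E := E) R) :=
    measurable_pi_lambda _ fun _ => measurable_pi_apply _
  exact h (measurableSet_singleton τ)

theorem isClopen_cell [TopologicalSpace E] [DiscreteTopology E]
    {R : ℕ} (τ : Box d R → E) : IsClopen (cell τ) := by
  have h : Continuous (pattern (d := d) (E := E) R) :=
    continuous_pi fun _ => continuous_apply _
  exact (isClopen_discrete {τ}).preimage h

namespace Walk

open Classical in
/-- The probability of the jump `z` in an environment with pattern `τ` at the current site. -/
noncomputable def patternProb (W : Walk d E) (τ : Box d W.R → E) (z : Fin d → ℤ) : ENNReal :=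
  if h : ∃ η : Env d E, pattern W.R η = τ then W.α h.choose z else 0

/-- By locality of α, the environment chosen to realise the pattern is immaterial. -/
theorem patternProb_pattern (W : Walk d E) (η : Env d E) (z : Fin d → ℤ) :
    W.patternProb (pattern W.R η) z = W.α η z := by
  have h : ∃ σ : Env d E, pattern W.R σ = pattern W.R η := ⟨η, rfl⟩
  rw [patternProb, dif_pos h]
  rw [W.local_dep h.choose η fun x hx => congrFun h.choose_spec ⟨x, hx⟩]

theorem exists_env_of_patternProb_ne_zero (W : Walk d E) {τ : Box d W.R → E} {z : Fin d → ℤ}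
    (h : W.patternProb τ z ≠ 0) : ∃ η : Env d E, pattern W.R η = τ ∧ 0 < W.α η z := by
  rw [patternProb] at h
  split_ifs at h with h'
  · exact ⟨h'.choose, h'.choose_spec, pos_iff_ne_zero.2 h⟩
  · exact absurd rfl h

theorem patternProb_ne_top (W : Walk d E) (τ : Box d W.R → E) (z : Fin d → ℤ) :
    W.patternProb τ z ≠ ⊤ := by
  rw [patternProb]
  split_ifs
  · exact PMF.apply_ne_top _ _
  · exact ENNReal.zero_ne_top

theorem shift_preimage_preimage (x : Fin d → ℤ) (t : ℤ) (A : Set (Env d E)) :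
    shift x t ⁻¹' (shift (-x) (-t) ⁻¹' A) = A := by
  ext η
  simp [shift_shift]

/-! ### The one-step operator of the environment process -/

section Step

/-- The probability, in the environment `η`, that the environment seen after one step is in `B`. -/
noncomputable def stepProb (W : Walk d E) (B : Set (Env d E)) (η : Env d E) : ENNReal :=
  ∑' z, W.α η z * B.indicator 1 (shift z 1 η)

/-- The Markov property: the history up to time t and X_{t+1} are jointly distributed as the history
law composed with the step kernel, which depends only on the environment seen from X_t. -/
theorem quenchedLaw_succ_mem (W : Walk d E) (η : Env d E) (t : ℕ) (B : Set (Env d E)) :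
    W.quenchedLaw η {X | shift (X (t + 1)) ((t + 1 : ℕ) : ℤ) η ∈ B} =
      ∫⁻ X, W.stepProb B (shift (X t) t η) ∂W.quenchedLaw η := by
  have hS : MeasurableSet {x : Fin d → ℤ | shift x ((t + 1 : ℕ) : ℤ) η ∈ B} :=
    Set.to_countable _ |>.measurableSet
  have hpair : Measurable fun X : ℕ → Fin d → ℤ =>
      (Preorder.frestrictLe (π := fun _ => Fin d → ℤ) t X, X (t + 1)) :=
    (Preorder.measurable_frestrictLe t).prodMk (measurable_pi_apply _)
  have h1 : {X : ℕ → Fin d → ℤ | shift (X (t + 1)) ((t + 1 : ℕ) : ℤ) η ∈ B} =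
      (fun X => (Preorder.frestrictLe (π := fun _ => Fin d → ℤ) t X, X (t + 1))) ⁻¹'
        (Set.univ ×ˢ {x | shift x ((t + 1 : ℕ) : ℤ) η ∈ B}) := by
    ext X; simp
  rw [h1, ← Measure.map_apply hpair (MeasurableSet.univ.prod hS), quenchedLaw,
    ← Kernel.partialTraj_compProd_eq_map_traj (Nat.zero_le t),
    Measure.compProd_apply_prod MeasurableSet.univ hS, Measure.restrict_univ,
    ← Kernel.traj_map_frestrictLe_apply,
    lintegral_map (Kernel.measurable_coe _ hS) (Preorder.measurable_frestrictLe t)]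
  refine lintegral_congr fun X => ?_
  change PMF.toMeasure (PMF.map (fun z => X t + z) (W.α (shift (X t) t η))) _ = _
  rw [← PMF.toMeasure_map _ _ (measurable_of_countable _), Measure.map_apply
    (measurable_of_countable _) hS, PMF.toMeasure_apply _ (Set.to_countable _).measurableSet,
    stepProb]
  refine tsum_congr fun z => ?_
  have h2 : shift z 1 (shift (X t) (t : ℤ) η) = shift (X t + z) ((t + 1 : ℕ) : ℤ) η := by
    rw [shift_shift, add_comm z, add_comm (1 : ℤ), Nat.cast_succ]
  rw [h2]
  by_cases hz : shift (X t + z) ((t + 1 : ℕ) : ℤ) η ∈ B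
  · rw [Set.indicator_of_mem (by exact hz), Set.indicator_of_mem hz, Pi.one_apply, mul_one]
  · rw [Set.indicator_of_notMem (by exact hz), Set.indicator_of_notMem hz, mul_zero]

variable [Finite E]

/-- Bounded range and locality leave finitely many jumps and patterns; only the pattern of η itself
contributes. -/
theorem stepProb_eq_sum (W : Walk d E) (B : Set (Env d E)) (η : Env d E) :
    W.stepProb B η = ∑ i : (Box d W.R → E) × Jump d W.R,
      (shift i.2.1 1 ⁻¹' B ∩ cell i.1).indicator (fun _ => W.patternProb i.1 i.2.1) η := by
  have h1 : W.stepProb B η = ∑' z : Jump d W.R, W.α η z.1 * B.indicator 1 (shift z.1 1 η) := by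
    rw [stepProb]
    refine (tsum_subtype_eq_of_support_subset (s := {z | norm1 z ≤ W.R}) ?_).symm
    intro z hz
    refine W.range_bdd η z (pos_iff_ne_zero.2 fun h => hz ?_)
    simp [h]
  rw [h1, tsum_fintype]
  rw [Fintype.sum_prod_type_right]
  refine Finset.sum_congr rfl fun z _ => ?_
  rw [Finset.sum_eq_single (pattern W.R η)]
  · by_cases hz : shift z.1 1 η ∈ B
    · rw [Set.indicator_of_mem hz, Set.indicator_of_mem (by exact ⟨hz, rfl⟩),
        patternProb_pattern, Pi.one_apply, mul_one]
    · rw [Set.indicator_of_notMem hz, Set.indicator_of_notMem (fun h => hz h.1), mul_zero]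
  · intro τ _ hτ
    exact Set.indicator_of_notMem (fun h => hτ h.2.symm) _
  · exact fun h => absurd (Finset.mem_univ _) h

variable [MeasurableSpace E]

/-- The one-step evolution of the law of the environment process, as a linear map on measures. -/
noncomputable def stepLaw (W : Walk d E) : Module.End ENNReal (Measure (Env d E)) :=
  ∑ i : (Box d W.R → E) × Jump d W.R, W.patternProb i.1 i.2.1 •
    (Measure.mapₗ (shift i.2.1 1) ∘ₗ Measure.restrictₗ (cell i.1))

theorem stepLaw_eq_sum (W : Walk d E) (ν : Measure (Env d E)) :
    W.stepLaw ν = ∑ i : (Box d W.R → E) × Jump d W.R, W.patternProb i.1 i.2.1 •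
      (ν.restrict (cell i.1)).map (shift i.2.1 1) := by
  rw [stepLaw, LinearMap.sum_apply]
  refine Finset.sum_congr rfl fun i _ => ?_
  rw [LinearMap.smul_apply, LinearMap.comp_apply,
    Measure.mapₗ_apply_of_measurable (measurable_shift _ _), Measure.restrictₗ_apply]

theorem stepLaw_apply (W : Walk d E) (ν : Measure (Env d E)) {B : Set (Env d E)}
    (hB : MeasurableSet B) :
    W.stepLaw ν B = ∑ i : (Box d W.R → E) × Jump d W.R, W.patternProb i.1 i.2.1 *
      ν (shift i.2.1 1 ⁻¹' B ∩ cell i.1) := by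
  rw [stepLaw_eq_sum, Measure.finsetSum_apply]
  refine Finset.sum_congr rfl fun i _ => ?_
  rw [Measure.smul_apply, Measure.map_apply (measurable_shift _ _) hB,
    Measure.restrict_apply (measurable_shift _ _ hB), smul_eq_mul]

variable [DiscreteMeasurableSpace E]

theorem measurable_stepProb (W : Walk d E) {B : Set (Env d E)} (hB : MeasurableSet B) :
    Measurable (W.stepProb B) :=
  Measurable.tsum fun z => (W.measurable_α z).mul
    ((measurable_one.indicator hB).comp (measurable_shift z 1))

theorem lintegral_stepProb (W : Walk d E) (ν : Measure (Env d E)) {B : Set (Env d E)}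
    (hB : MeasurableSet B) : ∫⁻ η, W.stepProb B η ∂ν = W.stepLaw ν B := by
  have hm : ∀ i : (Box d W.R → E) × Jump d W.R,
      MeasurableSet (shift i.2.1 1 ⁻¹' B ∩ cell i.1) :=
    fun i => (measurable_shift _ _ hB).inter (measurableSet_cell _)
  simp_rw [stepProb_eq_sum, W.stepLaw_apply ν hB]
  rw [lintegral_finsetSum _ fun i _ => measurable_const.indicator (hm i)]
  exact Finset.sum_congr rfl fun i _ => lintegral_indicator_const (hm i) _

theorem envLaw_apply (W : Walk d E) (Q : Measure (Env d E)) [IsProbabilityMeasure Q] (t : ℕ)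
    {B : Set (Env d E)} (hB : MeasurableSet B) :
    W.envLaw Q t B = ∫⁻ η, W.quenchedLaw η {X | shift (X t) t η ∈ B} ∂Q := by
  rw [envLaw, Measure.map_apply (measurable_envProcess t) hB, jointLaw,
    Measure.compProd_apply (measurable_envProcess t hB)]
  rfl

theorem envLaw_zero (W : Walk d E) (Q : Measure (Env d E)) [IsProbabilityMeasure Q] :
    W.envLaw Q 0 = Q := by
  ext B hB
  rw [W.envLaw_apply Q 0 hB, ← lintegral_indicator_one hB]
  refine lintegral_congr fun η => ?_
  have hX : Measurable fun X : ℕ → Fin d → ℤ => X 0 := measurable_pi_apply 0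
  have h0 : ∀ᵐ X ∂W.quenchedLaw η, X 0 = 0 := by
    have h := W.quenchedLaw_path η (fun _ => 0) rfl 0
    simp only [Nat.le_zero, forall_eq, Finset.range_zero, Finset.prod_empty] at h
    exact (prob_compl_eq_zero_iff (hX (measurableSet_singleton _))).2 h
  by_cases hη : η ∈ B
  · rw [Set.indicator_of_mem hη, Pi.one_apply]
    have hm : MeasurableSet {X : ℕ → Fin d → ℤ | shift (X 0) ((0 : ℕ) : ℤ) η ∈ B} :=
      hX (Set.to_countable {x | shift x ((0 : ℕ) : ℤ) η ∈ B}).measurableSet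
    rw [← mem_ae_iff_prob_eq_one hm]
    filter_upwards [h0] with X hX
    simpa [hX] using hη
  · rw [Set.indicator_of_notMem hη]
    refine measure_eq_zero_iff_ae_notMem.2 ?_
    filter_upwards [h0] with X hX
    simpa [hX] using hη

theorem envLaw_succ (W : Walk d E) (Q : Measure (Env d E)) [IsProbabilityMeasure Q] (t : ℕ) :
    W.envLaw Q (t + 1) = W.stepLaw (W.envLaw Q t) := by
  ext B hB
  rw [W.envLaw_apply Q _ hB, ← W.lintegral_stepProb _ hB, envLaw,
    lintegral_map (W.measurable_stepProb hB) (measurable_envProcess t), jointLaw,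
    Measure.lintegral_compProd (f := fun ω => W.stepProb B (envProcess t ω))
      ((W.measurable_stepProb hB).comp (measurable_envProcess t))]
  exact lintegral_congr fun η => W.quenchedLaw_succ_mem η t B

theorem envLaw_eq_pow (W : Walk d E) (Q : Measure (Env d E)) [IsProbabilityMeasure Q] (t : ℕ) :
    W.envLaw Q t = (W.stepLaw ^ t) Q := by
  induction t with
  | zero => simp [envLaw_zero]
  | succ t ih => rw [envLaw_succ, ih, pow_succ']; rfl

end Step

end Walk

end RWDRE

/-! ### Closeness to P relative to total mass -/

namespace RWDRE

variable {d : ℕ} {E : Type*}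

section

variable [MeasurableSpace E]

/-- The measure of `B` under `ν`, relative to the total mass of `ν`, is within `c` of its measure
under `P`. -/
def MassNear (P : Measure (Env d E)) (c : ENNReal) (B : Set (Env d E)) (ν : Measure (Env d E)) :
    Prop :=
  ν B ≤ ν Set.univ * (P B + c) ∧ ν Set.univ * P B ≤ ν B + ν Set.univ * c

namespace MassNear

variable {P : Measure (Env d E)} {c : ENNReal} {B : Set (Env d E)}

theorem zero : MassNear P c B 0 := by
  simp [MassNear]

theorem self [IsProbabilityMeasure P] : MassNear P c B P := by
  simp [MassNear]

theorem smul {ν : Measure (Env d E)} (h : MassNear P c B ν) (w : ENNReal) :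
    MassNear P c B (w • ν) := by
  simp only [MassNear, Measure.smul_apply, smul_eq_mul, mul_assoc]
  rw [← mul_add]
  exact ⟨mul_le_mul_right h.1 w, mul_le_mul_right h.2 w⟩

/-- Both inequalities are linear in ν and free of subtraction, so mixtures of unnormalised
conditional laws keep the same constant. -/
theorem sum {ι : Type*} {s : Finset ι} {ν : ι → Measure (Env d E)}
    (h : ∀ i ∈ s, MassNear P c B (ν i)) : MassNear P c B (∑ i ∈ s, ν i) := by
  simp only [MassNear, Measure.finsetSum_apply, Finset.sum_mul]
  rw [← Finset.sum_add_distrib]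
  exact ⟨Finset.sum_le_sum fun i hi => (h i hi).1, Finset.sum_le_sum fun i hi => (h i hi).2⟩

theorem restrict [IsProbabilityMeasure P] {A : Set (Env d E)} (hA : MeasurableSet A)
    (hA0 : P A ≠ 0) (hB : MeasurableSet B) {ε : ℝ} (hε : 0 ≤ ε)
    (h : |(P[|A]).real B - P.real B| ≤ ε) : MassNear P (ENNReal.ofReal ε) B (P.restrict A) := by
  have hAt : P A ≠ ⊤ := measure_ne_top P A
  have hr : P.restrict A B = P A * P[|A] B := by
    rw [cond_apply hA, ← mul_assoc, ENNReal.mul_inv_cancel hA0 hAt, one_mul,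
      Measure.restrict_apply hB, Set.inter_comm]
  have : IsProbabilityMeasure (P[|A]) := cond_isProbabilityMeasure hA0
  have hle : ∀ μ ν : Measure (Env d E), IsFiniteMeasure μ → IsFiniteMeasure ν →
      μ.real B ≤ ν.real B + ε → μ B ≤ ν B + ENNReal.ofReal ε := by
    intro μ ν _ _ hμν
    rw [← ofReal_measureReal (μ := μ), ← ofReal_measureReal (μ := ν),
      ← ENNReal.ofReal_add measureReal_nonneg hε]
    exact ENNReal.ofReal_le_ofReal hμν
  rw [MassNear, hr, Measure.restrict_apply_univ, ← mul_add]
  constructor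
  · exact mul_le_mul_right (hle _ _ inferInstance inferInstance (by linarith [(abs_le.1 h).2])) _
  · exact mul_le_mul_right (hle _ _ inferInstance inferInstance (by linarith [(abs_le.1 h).1])) _

theorem of_probability {ν : Measure (Env d E)} [IsProbabilityMeasure ν] :
    MassNear P c B ν ↔ ν B ≤ P B + c ∧ P B ≤ ν B + c := by
  simp [MassNear]

end MassNear

end

/-! ### Path observations and their evolution -/

namespace Walk

/-- The event that the environments seen along the backward path `γ` at times `-k, …, -1` agree with
`σ` on `[-R, R]^d`. -/
def pathEvent (R k : ℕ) (γ : ℤ → Fin d → ℤ) (σ : Env d E) : Set (Env d E) :=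
  {η | ∀ i : ℤ, -k ≤ i → i ≤ -1 → ∀ y : Fin d → ℤ, (∀ j, |y j| ≤ (R : ℤ)) →
      shift (γ i) i η (y, 0) = σ (y, i)}

theorem pathEvent_zero (R : ℕ) (γ : ℤ → Fin d → ℤ) (σ : Env d E) :
    pathEvent R 0 γ σ = Set.univ := by
  refine Set.eq_univ_of_forall fun η i h1 h2 => ?_
  exact absurd (h1.trans h2) (by norm_num)

/-- Prolonging a backward path by one step. -/
theorem shift_preimage_pathEvent_inter_cell (R k : ℕ) (γ : ℤ → Fin d → ℤ) (h0 : γ 0 = 0)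
    (σ τ : Env d E) (z : Fin d → ℤ) :
    shift (-z) (-1) ⁻¹' (pathEvent R k γ σ ∩ cell (pattern R τ)) =
      pathEvent R (k + 1) (fun i => if i = 0 then 0 else γ (i + 1) - z)
        (fun p => if p.2 = -1 then τ (p.1, 0) else σ (p.1, p.2 + 1)) := by
  ext η
  constructor
  · rintro ⟨h1, h2⟩ i hi hi' y hy
    have hi0 : i ≠ 0 := by omega
    -- Time -1 carries the newly observed pattern τ, at position γ 0 - z = -z; earlier times carry
    -- the old path moved back by one.
    by_cases hi1 : i = -1
    · subst hi1
      have := congrFun h2 ⟨y, hy⟩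
      simp only [pattern, shift] at this
      simpa [shift, h0] using this
    · have := h1 (i + 1) (by push_cast at hi; omega) (by omega) y hy
      simp only [shift] at this ⊢
      simp only [hi0, hi1, if_false]
      rw [← this]
      congr 1
      ext1
      · simp only []; abel
      · simp
  · intro h
    refine ⟨fun i hi hi' y hy => ?_, funext fun y => ?_⟩
    · have := h (i - 1) (by push_cast; omega) (by omega) y hy
      have hi0 : i - 1 ≠ 0 := by omega
      have hi1 : i - 1 ≠ -1 := by omega
      simp only [shift, hi0, hi1, if_false, sub_add_cancel] at this
      rw [← this]
      simp only [shift]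
      congr 1
      ext1
      · simp only []; abel
      · simp only []; abel
    · have := h (-1) (by push_cast; omega) le_rfl y.1 y.2
      simpa [shift, h0, pattern] using this

variable [MeasurableSpace E] [DiscreteMeasurableSpace E]

theorem measurableSet_pathEvent (R k : ℕ) (γ : ℤ → Fin d → ℤ)
    (σ : Env d E) : MeasurableSet (pathEvent R k γ σ) := by
  simp only [pathEvent, Set.ofPred_forall]
  refine MeasurableSet.iInter fun i => MeasurableSet.iInter fun _ => MeasurableSet.iInter fun _ =>
    MeasurableSet.iInter fun y => MeasurableSet.iInter fun _ => ?_
  exact ((measurable_pi_apply (y, 0)).comp (measurable_shift (γ i) i))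
    (measurableSet_singleton (σ (y, i)))

variable [Finite E]

/-- Each step trades one power of `stepLaw` for one more step of the path, hence the induction on t
with the path arbitrary. Once no power is left, the mixing hypothesis applies. -/
theorem massNear_stepLaw_pow_restrict_pathEvent (W : Walk d E) (P : Measure (Env d E))
    [IsProbabilityMeasure P] (hP : ∀ (x : Fin d → ℤ) (t : ℤ), P.map (shift x t) = P)
    {ε : ℝ} (hε : 0 ≤ ε) {B : Set (Env d E)} (hB : MeasurableSet B)
    (hmix : ∀ A ∈ W.observations P, |(P[|A]).real B - P.real B| ≤ ε) (t : ℕ) :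
    ∀ (k : ℕ) (γ : ℤ → Fin d → ℤ) (σ : Env d E), γ 0 = 0 →
      (∀ i : ℤ, -k < i → i ≤ 0 → γ i - γ (i - 1) ∈ W.jumpRange) →
      MassNear P (ENNReal.ofReal ε) B ((W.stepLaw ^ t) (P.restrict (pathEvent W.R k γ σ))) := by
  induction t with
  | zero =>
    intro k γ σ h0 hγ
    rw [pow_zero, Module.End.one_apply]
    -- Observations have k ≥ 1 and positive probability, so the empty path (P itself) and null
    -- events are treated apart.
    rcases Nat.eq_zero_or_pos k with rfl | hk
    · rw [pathEvent_zero, Measure.restrict_univ]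
      exact MassNear.self
    by_cases hA : P (pathEvent W.R k γ σ) = 0
    · rw [Measure.restrict_eq_zero.2 hA]
      exact MassNear.zero
    exact MassNear.restrict (measurableSet_pathEvent _ _ _ _) hA hB hε
      (hmix _ ⟨k, γ, σ, hk, h0, hγ, rfl, pos_iff_ne_zero.2 hA⟩)
  | succ t ih =>
    intro k γ σ h0 hγ
    -- The innermost factor is peeled off, so that it acts on the restricted P and the induction
    -- hypothesis handles the rest.
    rw [pow_succ, Module.End.mul_apply, stepLaw_eq_sum, map_sum]
    refine MassNear.sum fun i _ => ?_
    rw [map_smul]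
    by_cases hw : W.patternProb i.1 i.2.1 = 0
    · rw [hw, zero_smul]
      exact MassNear.zero
    obtain ⟨τ, hτ, hα⟩ := W.exists_env_of_patternProb_ne_zero hw
    have hm : MeasurableSet (shift (-i.2.1) (-1) ⁻¹' (pathEvent W.R k γ σ ∩ cell i.1)) :=
      measurable_shift _ _ ((measurableSet_pathEvent _ _ _ _).inter (measurableSet_cell _))
    -- Shift invariance turns the image of a restriction of P back into a restriction of P.
    have hr : ((P.restrict (pathEvent W.R k γ σ)).restrict (cell i.1)).map (shift i.2.1 1) =
        P.restrict (shift (-i.2.1) (-1) ⁻¹' (pathEvent W.R k γ σ ∩ cell i.1)) := by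
      conv_rhs => rw [← hP i.2.1 1]
      rw [Measure.restrict_map (measurable_shift _ _) hm, shift_preimage_preimage,
        Measure.restrict_restrict (measurableSet_cell _), Set.inter_comm]
    refine MassNear.smul ?_ _
    rw [hr, ← hτ, shift_preimage_pathEvent_inter_cell _ _ _ h0]
    refine ih (k + 1) _ _ (if_pos rfl) fun j hj hj' => ?_
    -- The last increment is the new jump z, admissible because it has positive probability under τ;
    -- the others are old increments.
    rcases hj'.eq_or_lt with rfl | hj0
    · refine ⟨τ, ?_⟩
      simpa [h0] using hα
    · have h1 : j - 1 ≠ 0 := by omega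
      simp only [hj0.ne, h1, if_false, sub_add_cancel, sub_sub_sub_cancel_right]
      have := hγ (j + 1) (by push_cast at hj; omega) (by omega)
      rwa [add_sub_cancel_right] at this

theorem massNear_envLaw (W : Walk d E) (P : Measure (Env d E))
    [IsProbabilityMeasure P] (hP : ∀ (x : Fin d → ℤ) (t : ℤ), P.map (shift x t) = P)
    {ε : ℝ} (hε : 0 ≤ ε) {B : Set (Env d E)} (hB : MeasurableSet B)
    (hmix : ∀ A ∈ W.observations P, |(P[|A]).real B - P.real B| ≤ ε) (t : ℕ) :
    MassNear P (ENNReal.ofReal ε) B (W.envLaw P t) := by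
  obtain ⟨σ⟩ : Nonempty (Env d E) := nonempty_of_isProbabilityMeasure P
  have h := W.massNear_stepLaw_pow_restrict_pathEvent P hP hε hB hmix t 0 0 σ rfl
    fun i h1 h2 => absurd (h1.trans_le h2) (by norm_num)
  rwa [pathEvent_zero, Measure.restrict_univ, ← envLaw_eq_pow] at h

theorem massNear_cesaro (W : Walk d E) (P : ProbabilityMeasure (Env d E))
    (hP : ∀ (x : Fin d → ℤ) (t : ℤ), (P : Measure (Env d E)).map (shift x t) = P)
    {ε : ℝ} (hε : 0 ≤ ε) {B : Set (Env d E)} (hB : MeasurableSet B)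
    (hmix : ∀ A ∈ W.observations (P : Measure (Env d E)),
      |((P : Measure (Env d E))[|A]).real B - (P : Measure (Env d E)).real B| ≤ ε) (n : ℕ) :
    MassNear (P : Measure (Env d E)) (ENNReal.ofReal ε) B (W.cesaro P n : Measure (Env d E)) :=
  MassNear.smul (MassNear.sum fun t _ => W.massNear_envLaw _ hP hε hB hmix t) _

end Walk

end RWDRE

/-! ### Clopen events and approximation -/

namespace RWDRE

variable {d : ℕ} {E : Type*}

/-- The clopen events that depend on the coordinates in `Δ` only. -/
def clopenEvents [TopologicalSpace E] [MeasurableSpace E] (Δ : Set (Site d)) :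
    Set (Set (Env d E)) :=
  {B | IsClopen B ∧ MeasurableSet[cylinderEvents Δ] B}

theorem isSetAlgebra_clopenEvents [TopologicalSpace E] [MeasurableSpace E] (Δ : Set (Site d)) :
    IsSetAlgebra (clopenEvents (E := E) Δ) where
  empty_mem := ⟨isClopen_empty, @MeasurableSet.empty _ (cylinderEvents Δ)⟩
  compl_mem _ h := ⟨h.1.compl, h.2.compl⟩
  union_mem _ _ h h' := ⟨h.1.union h'.1, h.2.union h'.2⟩

theorem generateFrom_clopenEvents [TopologicalSpace E] [DiscreteTopology E] [MeasurableSpace E]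
    (Δ : Set (Site d)) :
    MeasurableSpace.generateFrom (clopenEvents (E := E) Δ) = cylinderEvents Δ := by
  refine le_antisymm (MeasurableSpace.generateFrom_le fun B hB => hB.2) ?_
  refine iSup₂_le fun p hp => ?_
  rintro _ ⟨S, hS, rfl⟩
  exact MeasurableSpace.measurableSet_generateFrom
    ⟨(isClopen_discrete S).preimage (continuous_apply p), measurable_cylinderEvent_apply hp hS⟩

theorem measurable_shift_cylinderEvents [MeasurableSpace E] {Δ Δ' : Set (Site d)}
    (x : Fin d → ℤ) (t : ℤ) (h : ∀ p ∈ Δ, (p.1 + x, p.2 + t) ∈ Δ') :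
    Measurable[cylinderEvents Δ', cylinderEvents Δ] (shift (E := E) x t) := by
  let : MeasurableSpace (Env d E) := cylinderEvents Δ'
  exact measurable_cylinderEvents_iff.2 fun p hp => measurable_cylinderEvent_apply (h p hp)

theorem forwardCone_subset_farHalfSpace (d R j : ℕ) : forwardCone d R j ⊆ farHalfSpace d j := by
  intro p hp
  have := hp.2.2
  exact ⟨hp.1, by omega⟩

theorem coneTail_le_halfSpaceTail (d : ℕ) (E : Type*) [MeasurableSpace E] (R : ℕ) :
    coneTail d E R ≤ halfSpaceTail d E :=
  iInf_mono fun j => cylinderEvents_mono (forwardCone_subset_farHalfSpace d R j)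

/-- Sites at time at least t are at distance at least t from the origin whatever x is, so unions
over x stay in 𝓕_{Λ(t)}. -/
theorem measurable_shift_farHalfSpace [MeasurableSpace E] (x : Fin d → ℤ) (t : ℕ) :
    Measurable[cylinderEvents (farHalfSpace d t), cylinderEvents (halfSpace d)]
      (shift (E := E) x t) := by
  refine measurable_shift_cylinderEvents x t fun p hp => ?_
  have hp' : 0 ≤ p.2 := hp
  exact ⟨by simp only []; omega, by simp only []; omega⟩

theorem tendsto_inv_mul_prob {Ω : Type*} [MeasurableSpace Ω] (Q : ℕ → Measure Ω)
    [∀ n, IsProbabilityMeasure (Q n)] (B : Set Ω) :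
    Tendsto (fun n : ℕ => ((n : ENNReal) + 1)⁻¹ * Q n B) atTop (𝓝 0) := by
  have h : Tendsto (fun n : ℕ => ((n : ENNReal) + 1)⁻¹) atTop (𝓝 0) := by
    have := (tendsto_add_atTop_iff_nat 1).2 ENNReal.tendsto_inv_nat_nhds_zero
    simpa using this
  refine tendsto_of_tendsto_of_tendsto_of_le_of_le tendsto_const_nhds h (fun _ => zero_le) ?_
  intro n
  exact (mul_le_mul_right prob_le_one _).trans (mul_one _).le

section Approximation

variable [TopologicalSpace E] [DiscreteTopology E] [MeasurableSpace E]

/-- Bounds on the difference of two probability measures extend from clopen events. -/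
theorem le_add_of_clopenEvents (P Q : Measure (Env d E)) [IsProbabilityMeasure P]
    [IsProbabilityMeasure Q] (c : ENNReal) (Δ : Set (Site d))
    (h : ∀ B ∈ clopenEvents Δ, P B ≤ Q B + c) {B : Set (Env d E)}
    (hB : MeasurableSet[cylinderEvents Δ] B) : P B ≤ Q B + c := by
  have hle : cylinderEvents (X := fun _ : Site d => E) Δ ≤ MeasurableSpace.pi :=
    cylinderEvents_le_pi
  refine ENNReal.le_of_forall_pos_le_add fun ε hε _ => ?_
  have hε' : (0 : ENNReal) < ε / 2 := ENNReal.half_pos (by simpa using hε.ne')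
  -- Approximating for P + Q gives one clopen event good for both measures; trimming to 𝓕_Δ keeps it
  -- in 𝓕_Δ.
  obtain ⟨A, hA, hAB⟩ := @exists_measure_symmDiff_lt_of_generateFrom_isSetRing _
    (cylinderEvents Δ) ((P + Q).trim hle) _ _ (isSetAlgebra_clopenEvents Δ).isSetRing
    ⟨{Set.univ}, Set.countable_singleton _, by
      simpa using (isSetAlgebra_clopenEvents Δ).univ_mem, by simp⟩
    (generateFrom_clopenEvents Δ).symm B hB (ε / 2) hε'
  rw [trim_measurableSet_eq hle (hA.2.symmDiff hB), Measure.add_apply] at hAB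
  have hPA : P B ≤ P A + P (symmDiff A B) := by
    refine (measure_mono ?_).trans (measure_union_le _ _)
    intro η hη
    by_cases hηA : η ∈ A
    · exact Or.inl hηA
    · exact Or.inr (Or.inr ⟨hη, hηA⟩)
  have hQA : Q A ≤ Q B + Q (symmDiff A B) := by
    refine (measure_mono ?_).trans (measure_union_le _ _)
    intro η hη
    by_cases hηB : η ∈ B
    · exact Or.inl hηB
    · exact Or.inr (Or.inl ⟨hη, hηB⟩)
  have hsum : P (symmDiff A B) + Q (symmDiff A B) ≤ ε :=
    hAB.le.trans ENNReal.half_le_self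
  calc P B ≤ P A + P (symmDiff A B) := hPA
    _ ≤ Q B + Q (symmDiff A B) + c + P (symmDiff A B) := by
      gcongr
      exact (h A hA).trans (by gcongr)
    _ = Q B + c + (P (symmDiff A B) + Q (symmDiff A B)) := by ring
    _ ≤ Q B + c + ε := by gcongr

end Approximation

namespace Walk

/-! ### Weak limits of the Cesàro averages -/

section Limit

variable [Finite E] [MeasurableSpace E] [DiscreteMeasurableSpace E]

/-- Telescoping, with the boundary terms added on both sides because measures cannot be subtracted
freely. -/
theorem stepLaw_cesaro_add (W : Walk d E) (P : ProbabilityMeasure (Env d E)) (n : ℕ) :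
    W.stepLaw (W.cesaro P n) + ((n : ENNReal) + 1)⁻¹ • (P : Measure (Env d E)) =
      (W.cesaro P n : Measure (Env d E)) +
        ((n : ENNReal) + 1)⁻¹ • W.envLaw (P : Measure (Env d E)) (n + 1) := by
  change W.stepLaw (((n : ENNReal) + 1)⁻¹ • ∑ t ∈ Finset.range (n + 1), W.envLaw P t) + _ =
    ((n : ENNReal) + 1)⁻¹ • ∑ t ∈ Finset.range (n + 1), W.envLaw P t + _
  rw [map_smul, map_sum, ← smul_add, ← smul_add, ← Finset.sum_range_succ,
    Finset.sum_range_succ' _ (n + 1), envLaw_zero]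
  simp only [envLaw_succ]

variable [TopologicalSpace E] [DiscreteTopology E]

theorem exists_isEnvLimit (W : Walk d E) (P : ProbabilityMeasure (Env d E)) :
    ∃ Q, W.IsEnvLimit P Q := by
  obtain ⟨Q, n, hn, h⟩ := CompactSpace.tendsto_subseq (W.cesaro P)
  exact ⟨Q, n, hn, h⟩

theorem tendsto_cesaro_clopen {W : Walk d E} {P Q : ProbabilityMeasure (Env d E)} {n : ℕ → ℕ}
    (h : Tendsto (fun k => W.cesaro P (n k)) atTop (𝓝 Q)) {B : Set (Env d E)} (hB : IsClopen B) :
    Tendsto (fun k => (W.cesaro P (n k) : Measure (Env d E)) B) atTop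
      (𝓝 ((Q : Measure (Env d E)) B)) :=
  ProbabilityMeasure.tendsto_measure_of_null_frontier_of_tendsto' h (by simp [hB.frontier_eq])

/-- On a clopen event `stepLaw` is a finite combination of masses of clopen events, so it passes to
the limit; the boundary terms of the telescoping are O(1/n). -/
theorem stepLaw_eq_self_of_isEnvLimit (W : Walk d E) {P Q : ProbabilityMeasure (Env d E)}
    (h : W.IsEnvLimit P Q) : W.stepLaw (Q : Measure (Env d E)) = Q := by
  obtain ⟨n, hn, h⟩ := h
  have hclopen : ∀ B : Set (Env d E), IsClopen B →
      W.stepLaw (Q : Measure (Env d E)) B = (Q : Measure (Env d E)) B := by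
    intro B hB
    have hBm : MeasurableSet B := hB.isOpen.measurableSet
    have h1 : Tendsto (fun k => W.stepLaw (W.cesaro P (n k) : Measure (Env d E)) B) atTop
        (𝓝 (W.stepLaw (Q : Measure (Env d E)) B)) := by
      simp only [W.stepLaw_apply _ hBm]
      refine tendsto_finsetSum _ fun i _ => ?_
      refine ENNReal.Tendsto.const_mul (tendsto_cesaro_clopen h ?_)
        (Or.inr (W.patternProb_ne_top _ _))
      refine (hB.preimage ?_).inter (isClopen_cell _)
      exact continuous_pi fun p => continuous_apply _
    have h2 := tendsto_cesaro_clopen h hB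
    have h3 := (tendsto_inv_mul_prob (fun _ => (P : Measure (Env d E))) B).comp hn.tendsto_atTop
    have h4 := (tendsto_inv_mul_prob (fun m => W.envLaw (P : Measure (Env d E)) (m + 1)) B).comp
      hn.tendsto_atTop
    have h5 := h1.add h3
    have h6 := h2.add h4
    rw [add_zero] at h5 h6
    refine tendsto_nhds_unique h5 (h6.congr fun k => ?_)
    have := congrArg (fun μ : Measure (Env d E) => μ B) (W.stepLaw_cesaro_add P (n k))
    exact this.symm
  refine (ext_of_generate_finite _
    (cylinderEvents_univ.symm.trans (generateFrom_clopenEvents (E := E) Set.univ).symm)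
    (isSetAlgebra_clopenEvents Set.univ).isSetRing.isSetSemiring.isPiSystem
    (fun B hB => (hclopen B hB.1).symm) (hclopen _ isClopen_univ).symm).symm

theorem massNear_of_isEnvLimit (W : Walk d E) {P Q : ProbabilityMeasure (Env d E)}
    (hP : ∀ (x : Fin d → ℤ) (t : ℤ), (P : Measure (Env d E)).map (shift x t) = P)
    (h : W.IsEnvLimit P Q) {ε : ℝ} (hε : 0 ≤ ε) (Δ : Set (Site d))
    (hmix : ∀ B : Set (Env d E), MeasurableSet[cylinderEvents Δ] B →
      ∀ A ∈ W.observations (P : Measure (Env d E)),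
      |((P : Measure (Env d E))[|A]).real B - (P : Measure (Env d E)).real B| ≤ ε)
    {B : Set (Env d E)} (hB : MeasurableSet[cylinderEvents Δ] B) :
    (Q : Measure (Env d E)) B ≤ (P : Measure (Env d E)) B + ENNReal.ofReal ε ∧
      (P : Measure (Env d E)) B ≤ (Q : Measure (Env d E)) B + ENNReal.ofReal ε := by
  obtain ⟨n, -, h⟩ := h
  have hnear : ∀ A ∈ clopenEvents (E := E) Δ, ∀ k,
      MassNear (P : Measure (Env d E)) (ENNReal.ofReal ε) A (W.cesaro P (n k)) :=
    fun A hA k => W.massNear_cesaro P hP hε hA.1.isOpen.measurableSet (hmix A hA.2) _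
  constructor
  · refine le_add_of_clopenEvents _ _ _ Δ (fun A hA => ?_) hB
    exact le_of_tendsto' (tendsto_cesaro_clopen h hA.1)
      fun k => (MassNear.of_probability.1 (hnear A hA k)).1
  · refine le_add_of_clopenEvents _ _ _ Δ (fun A hA => ?_) hB
    exact ge_of_tendsto' ((tendsto_cesaro_clopen h hA.1).add_const _)
      fun k => (MassNear.of_probability.1 (hnear A hA k)).2

end Limit

/-! ### Null sets of a stationary law -/

section Stationary

variable [Finite E] [MeasurableSpace E] [DiscreteMeasurableSpace E]

theorem isInvariant_of_stepLaw_eq (W : Walk d E) (Q : Measure (Env d E)) [IsProbabilityMeasure Q]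
    (h : W.stepLaw Q = Q) : W.IsInvariant Q := by
  intro t
  induction t with
  | zero => exact W.envLaw_zero Q
  | succ t ih => rw [envLaw_succ, ih, h]

/-- The walk can reach B in one step only if some translate of the environment lies in B; the union
discards the dependence on the jump. -/
theorem measure_le_measure_iUnion_shift (W : Walk d E) {Q : Measure (Env d E)}
    (hQ : W.stepLaw Q = Q) {B : Set (Env d E)} (hB : MeasurableSet B) :
    Q B ≤ Q (⋃ z : Fin d → ℤ, shift z 1 ⁻¹' B) := by
  have hU : MeasurableSet (⋃ z : Fin d → ℤ, shift (E := E) z 1 ⁻¹' B) :=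
    MeasurableSet.iUnion fun z => measurable_shift z 1 hB
  conv_lhs => rw [← hQ, ← W.lintegral_stepProb Q hB]
  rw [← lintegral_indicator_one hU]
  refine lintegral_mono fun η => ?_
  by_cases hη : η ∈ ⋃ z : Fin d → ℤ, shift z 1 ⁻¹' B
  · rw [Set.indicator_of_mem hη, Pi.one_apply, ← (W.α η).tsum_coe]
    refine ENNReal.tsum_le_tsum fun z => ?_
    exact (mul_le_mul_right (Set.indicator_le_self' (fun _ _ => zero_le) _) _).trans (mul_one _).le
  · refine le_of_eq_of_le ?_ zero_le
    refine ENNReal.tsum_eq_zero.2 fun z => ?_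
    have hz : shift z 1 η ∉ B := fun h => hη (Set.mem_iUnion.2 ⟨z, h⟩)
    rw [Set.indicator_of_notMem hz, mul_zero]

theorem measure_le_measure_iUnion_shift_nat (W : Walk d E) {Q : Measure (Env d E)}
    (hQ : W.stepLaw Q = Q) {B : Set (Env d E)} (hB : MeasurableSet B) (t : ℕ) :
    Q B ≤ Q (⋃ x : Fin d → ℤ, shift x t ⁻¹' B) := by
  induction t with
  | zero =>
    refine measure_mono fun η hη => Set.mem_iUnion.2 ⟨0, ?_⟩
    simpa using hη
  | succ t ih =>
    refine ih.trans ((W.measure_le_measure_iUnion_shift hQ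
      (MeasurableSet.iUnion fun x => measurable_shift x t hB)).trans (measure_mono ?_))
    refine Set.iUnion_subset fun z η hη => ?_
    obtain ⟨x, hx⟩ := Set.mem_iUnion.1 hη
    refine Set.mem_iUnion.2 ⟨x + z, ?_⟩
    rw [Set.mem_preimage, shift_shift] at hx
    exact_mod_cast hx

/-- A stationary null set is almost surely entered with probability zero at the next step; since
standing still always has positive probability, θ_{o,1} almost surely avoids it. -/
theorem measure_shift_preimage_eq_zero (W : Walk d E) (hW : W.IsElliptic) {Q : Measure (Env d E)}
    (hQ : W.stepLaw Q = Q) {B : Set (Env d E)} (hB : MeasurableSet B) (h : Q B = 0) (t : ℕ) :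
    Q (shift 0 t ⁻¹' B) = 0 := by
  induction t with
  | zero =>
    refine measure_mono_null (fun η hη => ?_) h
    simpa using hη
  | succ t ih =>
    rw [← hQ, ← W.lintegral_stepProb Q (measurable_shift _ _ hB),
      lintegral_eq_zero_iff (W.measurable_stepProb (measurable_shift _ _ hB))] at ih
    refine measure_eq_zero_iff_ae_notMem.2 (ih.mono fun η hη hmem => ?_)
    have h0 := ENNReal.tsum_eq_zero.1 hη 0
    have hmem' : shift 0 1 η ∈ shift 0 (t : ℤ) ⁻¹' B := by
      rw [Set.mem_preimage, shift_shift]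
      rw [Set.mem_preimage] at hmem
      simpa using hmem
    rw [Set.indicator_of_mem hmem', Pi.one_apply, mul_one] at h0
    exact (hW 0 W.zero_mem η).ne' h0

end Stationary

end Walk

end RWDRE

/-! ### The theorem -/

theorem theorem1p4 {d : ℕ} {E : Type*} [Finite E] [TopologicalSpace E] [DiscreteTopology E]
    [MeasurableSpace E] [DiscreteMeasurableSpace E]
    (W : RWDRE.Walk d E) (P : ProbabilityMeasure (RWDRE.Env d E))
    (hP : ∀ (x : Fin d → ℤ) (t : ℤ),
      Measure.map (RWDRE.shift x t) (P : Measure (RWDRE.Env d E)) = P)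
    (φ : ℕ → ℝ) (hφ : ∀ l, φ l ∈ Set.Icc (0 : ℝ) 1) (hφ0 : Tendsto φ atTop (𝓝 0))
    (hmix : ∀ l : ℕ, ∀ B : Set (RWDRE.Env d E),
      MeasurableSet[cylinderEvents (RWDRE.farHalfSpace d l)] B →
      ∀ A ∈ W.observations (P : Measure (RWDRE.Env d E)),
        |((P : Measure (RWDRE.Env d E))[|A]).real B
          - (P : Measure (RWDRE.Env d E)).real B| ≤ φ l) :
    -- a law `P^{EP}` exists
    (∃ PEP : ProbabilityMeasure (RWDRE.Env d E), W.IsEnvLimit P PEP) ∧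
    ∀ PEP : ProbabilityMeasure (RWDRE.Env d E), W.IsEnvLimit P PEP →
      -- it is invariant and equals `P` on the tail of the forward cone
      W.IsInvariant (PEP : Measure (RWDRE.Env d E)) ∧
      (∀ B, MeasurableSet[RWDRE.coneTail d E W.R] B →
        (PEP : Measure (RWDRE.Env d E)) B = (P : Measure (RWDRE.Env d E)) B) ∧
      -- it equals `P` on the tail of the forward half-space
      (∀ B, MeasurableSet[RWDRE.halfSpaceTail d E] B →
        (PEP : Measure (RWDRE.Env d E)) B = (P : Measure (RWDRE.Env d E)) B) ∧
      -- quantitative bound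
      (∀ l : ℕ, ∀ B, MeasurableSet[cylinderEvents (RWDRE.farHalfSpace d l)] B →
        |(P : Measure (RWDRE.Env d E)).real B
          - (PEP : Measure (RWDRE.Env d E)).real B| ≤ φ l) ∧
      -- mutual absolute continuity on the forward half-space
      (W.IsElliptic →
        ∀ B, MeasurableSet[cylinderEvents (RWDRE.halfSpace d)] B →
          ((P : Measure (RWDRE.Env d E)) B = 0 ↔ (PEP : Measure (RWDRE.Env d E)) B = 0)) := by
  refine ⟨W.exists_isEnvLimit P, fun Q hQ => ?_⟩
  have hstep := W.stepLaw_eq_self_of_isEnvLimit hQ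
  have hnear : ∀ (l : ℕ) (B : Set (RWDRE.Env d E)),
      MeasurableSet[cylinderEvents (RWDRE.farHalfSpace d l)] B →
      (Q : Measure (RWDRE.Env d E)) B
          ≤ (P : Measure (RWDRE.Env d E)) B + ENNReal.ofReal (φ l) ∧
        (P : Measure (RWDRE.Env d E)) B
          ≤ (Q : Measure (RWDRE.Env d E)) B + ENNReal.ofReal (φ l) :=
    fun l B hB => W.massNear_of_isEnvLimit hP hQ (hφ l).1 _ (hmix l) hB
  have hlim : Tendsto (fun l => ENNReal.ofReal (φ l)) atTop (𝓝 0) := by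
    simpa using ENNReal.tendsto_ofReal hφ0
  have htail : ∀ B, MeasurableSet[RWDRE.halfSpaceTail d E] B →
      (Q : Measure (RWDRE.Env d E)) B = (P : Measure (RWDRE.Env d E)) B := by
    intro B hB
    have hB' : ∀ l, MeasurableSet[cylinderEvents (RWDRE.farHalfSpace d l)] B :=
      fun l => (iInf_le (fun l => cylinderEvents (RWDRE.farHalfSpace d l)) l) B hB
    refine le_antisymm ?_ ?_
    · have h := hlim.const_add ((P : Measure (RWDRE.Env d E)) B)
      rw [add_zero] at h
      exact ge_of_tendsto' h fun l => (hnear l B (hB' l)).1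
    · have h := hlim.const_add ((Q : Measure (RWDRE.Env d E)) B)
      rw [add_zero] at h
      exact ge_of_tendsto' h fun l => (hnear l B (hB' l)).2
  refine ⟨W.isInvariant_of_stepLaw_eq _ hstep,
    fun B hB => htail B (RWDRE.coneTail_le_halfSpaceTail d E W.R B hB), htail, ?_, ?_⟩
  · intro l B hB
    obtain ⟨h1, h2⟩ := hnear l B hB
    have hreal : ∀ μ ν : Measure (RWDRE.Env d E), IsProbabilityMeasure μ →
        IsProbabilityMeasure ν → μ B ≤ ν B + ENNReal.ofReal (φ l) →
        μ.real B ≤ ν.real B + φ l := by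
      intro μ ν _ _ h
      have := ENNReal.toReal_mono (by finiteness) h
      rwa [ENNReal.toReal_add (by finiteness) (by finiteness),
        ENNReal.toReal_ofReal (hφ l).1] at this
    have h1' := hreal _ _ inferInstance inferInstance h1
    have h2' := hreal _ _ inferInstance inferInstance h2
    exact abs_le.2 ⟨by linarith, by linarith⟩
  · intro hW B hB
    have hBm : MeasurableSet B := cylinderEvents_le_pi B hB
    constructor
    · intro h
      refine nonpos_iff_eq_zero.1 (ge_of_tendsto' hlim fun t => ?_)
      have hU : MeasurableSet[cylinderEvents (RWDRE.farHalfSpace d t)]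
          (⋃ x : Fin d → ℤ, RWDRE.shift (E := E) x t ⁻¹' B) :=
        MeasurableSet.iUnion fun x => RWDRE.measurable_shift_farHalfSpace x t hB
      -- A countable union of translates of a P-null event.
      have h0 : (P : Measure (RWDRE.Env d E)) (⋃ x : Fin d → ℤ, RWDRE.shift x t ⁻¹' B) = 0 := by
        refine measure_iUnion_null fun x => ?_
        rw [← Measure.map_apply (RWDRE.Walk.measurable_shift x t) hBm, hP, h]
      refine (W.measure_le_measure_iUnion_shift_nat hstep hBm t).trans ((hnear t _ hU).1.trans ?_)
      rw [h0, zero_add]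
    · intro h
      refine nonpos_iff_eq_zero.1 (ge_of_tendsto' hlim fun t => ?_)
      have h1 := (hnear t _ (RWDRE.measurable_shift_farHalfSpace 0 t hB)).2
      rwa [W.measure_shift_preimage_eq_zero hW hstep hBm h, zero_add,
        ← Measure.map_apply (RWDRE.Walk.measurable_shift 0 t) hBm, hP] at h1
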